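/- Let $\mathbb K$ be $\mathbb R$ or $\mathbb C$. A bounded operator $\varphi:X\to Y$ between normed spaces over $\mathbb K$ is called $2$-summing if there is a constant $C\ge 0$ such that $$\Big(\sum_{i}\|\varphi(x_i)\|^2\Big)^{1/2}\le C\sup_{f\in B_{X^*}}\Big(\sum_i|f(x_i)|^2\Big)^{1/2}$$ for every finite family $(x_i)$ in $X$, where $B_{X^*}$ is the closed unit ball of the dual of $X$; the smallest such $C$ is the $2$-summing norm $\pi_2(\varphi)$, with $\pi_2(\varphi)=+\infty$ if $\varphi$ is not $2$-summing. For normed spaces $X_1,X_2$, let $X_1\otimes_\varepsilon X_2$ be the algebraic tensor product with the injective norm $\|z\|_\varepsilon=\sup\{|\langle\alpha\otimes\beta,z\rangle|:\alpha\in B_{X_1^*},\ \beta\in B_{X_2^*}\}$ and $X_1\bar\otimes_\varepsilon X_2$ its completion. For Hilbert spaces $H_1,H_2$, let $H_1\otimes_h H_2$ be the algebraic tensor product with its canonical inner product and $H_1\bar\otimes_h H_2$ its completion. (1) Let $X_1,X_2$ be Banach spaces, $H_1,H_2$ Hilbert spaces, all over $\mathbb K$, and let $\varphi_1:X_1\to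 H_1$ and $\varphi_2:X_2\to H_2$ be $2$-summing operators. Then the algebraic tensor product $\varphi_1\otimes\varphi_2$ extends uniquely to a bounded operator $$\varphi_1\otimes\varphi_2:\ X_1\bar\otimes_\varepsilon X_2\to H_1\bar\otimes_h H_2,$$ and this operator is $2$-summing and satisfies $\pi_2(\varphi_1\otimes\varphi_2)=\pi_2(\varphi_1)\,\pi_2(\varphi_2)$. (2) Let $X_1,X_2$ be normed spaces and $H_1,H_2$ Hilbert spaces over $\mathbb K$, all of finite dimension. For all operators $\varphi_1:X_1\to H_1$ and $\varphi_2:X_2\to H_2$, the operator $\varphi_1\otimes\varphi_2:X_1\otimes_\varepsilon X_2\to H_1\otimes_h H_2$ is $2$-summing and satisfies $\pi_2(\varphi_1\otimes\varphi_2)=\pi_2(\varphi_1)\,\pi_2(\varphi_2)$. -/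

import Mathlib

open scoped TensorProduct NNReal ENNReal

noncomputable section

section TwoSumming

variable {𝕜 X Y : Type*} [RCLike 𝕜] [NormedAddCommGroup X] [NormedSpace 𝕜 X]
  [NormedAddCommGroup Y] [NormedSpace 𝕜 Y]

/-- The weak `ℓ²` norm `sup_{f ∈ B_{X*}} (∑ i, |f (x i)|²)^{1/2}` of a finite family in `X`.
The supremum is over a nonempty set that is bounded above by `(∑ i, ‖x i‖²)^{1/2}`. -/
def weakTwoNorm (𝕜 : Type*) {X : Type*} [RCLike 𝕜] [NormedAddCommGroup X] [NormedSpace 𝕜 X]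
    {n : ℕ} (x : Fin n → X) : ℝ :=
  ⨆ f : Metric.closedBall (0 : StrongDual 𝕜 X) 1,
    Real.sqrt (∑ i, ‖(f : StrongDual 𝕜 X) (x i)‖ ^ 2)

/-- The constant `C` satisfies the 2-summing inequality for `φ`, for all finite families. -/
def TwoSummingBound (φ : X →L[𝕜] Y) (C : ℝ≥0) : Prop :=
  ∀ (n : ℕ) (x : Fin n → X),
    Real.sqrt (∑ i, ‖φ (x i)‖ ^ 2) ≤ C * weakTwoNorm 𝕜 x

/-- A bounded operator is 2-summing if some constant satisfies the 2-summing inequality. -/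
def IsTwoSumming (φ : X →L[𝕜] Y) : Prop :=
  ∃ C : ℝ≥0, TwoSummingBound φ C

/-- The 2-summing norm `π₂(φ)`, the least constant in the 2-summing inequality; it is `∞` if
there is none. -/
def twoSummingNorm (φ : X →L[𝕜] Y) : ℝ≥0∞ :=
  ⨅ (C : ℝ≥0) (_ : TwoSummingBound φ C), (C : ℝ≥0∞)

end TwoSumming

/-- The algebraic tensor product `X ⊗ Y`, as a type of its own that carries the injective norm. -/
def InjectiveTensorProduct (𝕜 X Y : Type*) [RCLike 𝕜] [NormedAddCommGroup X] [NormedSpace 𝕜 X]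
    [NormedAddCommGroup Y] [NormedSpace 𝕜 Y] : Type _ :=
  X ⊗[𝕜] Y

namespace InjectiveTensorProduct

variable {𝕜 X Y : Type*} [RCLike 𝕜] [NormedAddCommGroup X] [NormedSpace 𝕜 X]
  [NormedAddCommGroup Y] [NormedSpace 𝕜 Y]

instance : AddCommGroup (InjectiveTensorProduct 𝕜 X Y) :=
  inferInstanceAs (AddCommGroup (X ⊗[𝕜] Y))

instance : Module 𝕜 (InjectiveTensorProduct 𝕜 X Y) :=
  inferInstanceAs (Module 𝕜 (X ⊗[𝕜] Y))

variable (𝕜 X Y) in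
/-- The identity map from `X ⊗ Y` with the injective norm to the algebraic tensor product. -/
def toTensor : InjectiveTensorProduct 𝕜 X Y ≃ₗ[𝕜] X ⊗[𝕜] Y :=
  LinearEquiv.refl 𝕜 (X ⊗[𝕜] Y)

/-- The scalar `⟨α ⊗ β, z⟩` for `z` in the algebraic tensor product. -/
def pairing (α : StrongDual 𝕜 X) (β : StrongDual 𝕜 Y) : InjectiveTensorProduct 𝕜 X Y →ₗ[𝕜] 𝕜 :=
  TensorProduct.dualDistrib 𝕜 X Y ((α : X →ₗ[𝕜] 𝕜) ⊗ₜ[𝕜] (β : Y →ₗ[𝕜] 𝕜)) ∘ₗ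
    (toTensor 𝕜 X Y).toLinearMap

/-- The injective norm `sup {|⟨α ⊗ β, z⟩| : α ∈ B_{X*}, β ∈ B_{Y*}}`. -/
def injectiveNorm (z : InjectiveTensorProduct 𝕜 X Y) : ℝ :=
  ⨆ p : Metric.closedBall (0 : StrongDual 𝕜 X) 1 × Metric.closedBall (0 : StrongDual 𝕜 Y) 1,
    ‖pairing (p.1 : StrongDual 𝕜 X) (p.2 : StrongDual 𝕜 Y) z‖

theorem pairing_tmul (α : StrongDual 𝕜 X) (β : StrongDual 𝕜 Y) (x : X) (y : Y) :
    pairing α β ((toTensor 𝕜 X Y).symm (x ⊗ₜ[𝕜] y)) = α x * β y := by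
  simp [pairing]

theorem bddAbove_pairing (z : InjectiveTensorProduct 𝕜 X Y) :
    BddAbove (Set.range fun p : Metric.closedBall (0 : StrongDual 𝕜 X) 1 ×
      Metric.closedBall (0 : StrongDual 𝕜 Y) 1 =>
        ‖pairing (p.1 : StrongDual 𝕜 X) (p.2 : StrongDual 𝕜 Y) z‖) := by
  obtain ⟨t, rfl⟩ := (toTensor 𝕜 X Y).symm.surjective z
  induction t with
  | zero => exact ⟨0, by rintro _ ⟨p, rfl⟩; simp⟩
  | tmul x y =>
    refine ⟨‖x‖ * ‖y‖, ?_⟩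
    rintro _ ⟨⟨⟨α, hα⟩, ⟨β, hβ⟩⟩, rfl⟩
    simp only [pairing_tmul, norm_mul]
    have hα' : ‖α‖ ≤ 1 := by simpa using hα
    have hβ' : ‖β‖ ≤ 1 := by simpa using hβ
    gcongr
    · exact α.le_of_opNorm_le hα' x |>.trans_eq (one_mul _)
    · exact β.le_of_opNorm_le hβ' y |>.trans_eq (one_mul _)
  | add s t hs ht =>
    obtain ⟨a, ha⟩ := hs
    obtain ⟨b, hb⟩ := ht
    refine ⟨a + b, ?_⟩
    rintro _ ⟨p, rfl⟩
    simp only [map_add]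
    exact (norm_add_le _ _).trans (add_le_add (ha ⟨p, rfl⟩) (hb ⟨p, rfl⟩))

/-- Functionals of the form `α ⊗ β` with `α`, `β` continuous separate the points of `X ⊗ Y`. -/
theorem eq_zero_of_pairing (z : InjectiveTensorProduct 𝕜 X Y)
    (h : ∀ (α : StrongDual 𝕜 X) (β : StrongDual 𝕜 Y), pairing α β z = 0) : z = 0 := by
  obtain ⟨t, rfl⟩ := (toTensor 𝕜 X Y).symm.surjective z
  obtain ⟨c, rfl⟩ := TensorProduct.eq_repr_basis_left (Module.Basis.ofVectorSpace 𝕜 X) t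
  set b := Module.Basis.ofVectorSpace 𝕜 X
  have hc : c = 0 := by
    ext i
    refine SeparatingDual.eq_zero_of_forall_dual_eq_zero (R := 𝕜) fun β => ?_
    have h0 : (c.sum fun i y => β y • b i) = 0 := by
      refine SeparatingDual.eq_zero_of_forall_dual_eq_zero (R := 𝕜) fun α => ?_
      have := h α β
      simp only [Finsupp.sum, map_sum, pairing_tmul] at this
      simpa [Finsupp.sum, map_sum, mul_comm] using this
    by_cases hi : i ∈ c.support
    · exact linearIndependent_iff'.mp b.linearIndependent c.support (fun i => β (c i)) h0 i hi
    · simp [Finsupp.notMem_support_iff.mp hi]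
  simp [hc]

theorem normCore :
    letI : Norm (InjectiveTensorProduct 𝕜 X Y) := ⟨injectiveNorm⟩
    NormedSpace.Core 𝕜 (InjectiveTensorProduct 𝕜 X Y) := by
  let _ : Norm (InjectiveTensorProduct 𝕜 X Y) := ⟨injectiveNorm⟩
  have : Nonempty (Metric.closedBall (0 : StrongDual 𝕜 X) 1 ×
      Metric.closedBall (0 : StrongDual 𝕜 Y) 1) := ⟨⟨⟨0, by simp⟩, ⟨0, by simp⟩⟩⟩
  refine { norm_nonneg := fun z => ?_, norm_smul := fun c z => ?_, norm_triangle := fun y z => ?_,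
           norm_eq_zero_iff := fun z => ⟨fun hz => ?_, fun hz => ?_⟩ }
  · exact Real.iSup_nonneg fun _ => norm_nonneg _
  · change injectiveNorm _ = _ * injectiveNorm _
    simp only [injectiveNorm, map_smul, norm_smul]
    rw [Real.mul_iSup_of_nonneg (norm_nonneg c)]
  · refine ciSup_le fun p => ?_
    rw [map_add]
    exact (norm_add_le _ _).trans
      (add_le_add (le_ciSup (bddAbove_pairing y) p) (le_ciSup (bddAbove_pairing z) p))
  · refine eq_zero_of_pairing z fun α β => ?_
    have key : ∀ (α : StrongDual 𝕜 X) (β : StrongDual 𝕜 Y), ‖α‖ ≤ 1 → ‖β‖ ≤ 1 →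
        pairing α β z = 0 := fun α β hα hβ => by
      have := le_ciSup (bddAbove_pairing z) ⟨⟨α, by simpa using hα⟩, ⟨β, by simpa using hβ⟩⟩
      exact norm_le_zero_iff.mp (this.trans_eq hz)
    have hs : ∀ r s : 𝕜, pairing (r • α) (s • β) z = (r * s) * pairing α β z := by
      intro r s
      simp only [pairing, LinearMap.comp_apply, ContinuousLinearMap.toLinearMap_smul,
        TensorProduct.smul_tmul_smul, map_smul, LinearMap.smul_apply, smul_eq_mul]
    have hn : ∀ r : ℝ, 0 ≤ r → ‖(((1 + r : ℝ) : 𝕜)⁻¹)‖ * r ≤ 1 ∧ (((1 + r : ℝ) : 𝕜)⁻¹) ≠ 0 := by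
      intro r hr
      have hpos : 0 < 1 + r := by positivity
      refine ⟨?_, inv_ne_zero (RCLike.ofReal_ne_zero.mpr hpos.ne')⟩
      rw [norm_inv, RCLike.norm_ofReal, abs_of_pos hpos, inv_mul_le_iff₀ hpos]
      linarith
    have := key _ _ ((norm_smul_le _ α).trans (hn _ (norm_nonneg α)).1)
      ((norm_smul_le _ β).trans (hn _ (norm_nonneg β)).1)
    rw [hs] at this
    exact (mul_eq_zero.mp this).resolve_left
      (mul_ne_zero (hn _ (norm_nonneg _)).2 (hn _ (norm_nonneg _)).2)
  · subst hz
    change injectiveNorm _ = _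
    simp [injectiveNorm]

instance : NormedAddCommGroup (InjectiveTensorProduct 𝕜 X Y) :=
  letI : Norm (InjectiveTensorProduct 𝕜 X Y) := ⟨injectiveNorm⟩
  NormedAddCommGroup.ofCore normCore

instance : NormedSpace 𝕜 (InjectiveTensorProduct 𝕜 X Y) :=
  letI : Norm (InjectiveTensorProduct 𝕜 X Y) := ⟨injectiveNorm⟩
  NormedSpace.ofCore normCore

theorem norm_def (z : InjectiveTensorProduct 𝕜 X Y) :
    ‖z‖ = ⨆ p : Metric.closedBall (0 : StrongDual 𝕜 X) 1 × Metric.closedBall (0 : StrongDual 𝕜 Y) 1,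
      ‖pairing (p.1 : StrongDual 𝕜 X) (p.2 : StrongDual 𝕜 Y) z‖ :=
  rfl

/-- The algebraic tensor product `φ₁ ⊗ φ₂` of two operators, as a linear map from the tensor
product with the injective norm. -/
def map {Z W : Type*} [NormedAddCommGroup Z] [InnerProductSpace 𝕜 Z]
    [NormedAddCommGroup W] [InnerProductSpace 𝕜 W] (φ₁ : X →L[𝕜] Z) (φ₂ : Y →L[𝕜] W) :
    InjectiveTensorProduct 𝕜 X Y →ₗ[𝕜] Z ⊗[𝕜] W :=
  TensorProduct.map (φ₁ : X →ₗ[𝕜] Z) (φ₂ : Y →ₗ[𝕜] W) ∘ₗ (toTensor 𝕜 X Y).toLinearMap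

end InjectiveTensorProduct

end

/-! Upper bound (`sum_sq_norm_map_le`): choose a finite orthonormal family `b l` in `H₁` whose
contractions compute the norms of all `(φ₁ ⊗ φ₂)(z i)`. Each contraction is `φ₂` applied to `w (i,
l) = (⟨b l, φ₁ ·⟩ ⊗ id)(z i)`, so the inequality for `φ₂` leaves the weak norm of `w`. For `g` in
the dual ball, `g (w (i, l)) = ⟨b l, φ₁ (v i)⟩` with `v i = (id ⊗ g)(z i)`. Bessel's inequality
removes `l`, the inequality for `φ₁` removes `φ₁`, and the weak norm of `v` is controlled because `f
⊗ g` lies in the dual ball of the injective tensor product.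

Lower bound (`mul_le_of_twoSummingBound`): on families `x i ⊗ y j` the Hilbert norms factor, and the
weak norm is at most the product of the two weak norms (`IsWeakTwoBound.tmul`).

Density carries the constants to the completions, and in finite dimension every operator here is
2-summing. -/

/-! ### Weak `ℓ²` bounds of finite families. -/

section WeakTwoBound

variable {𝕜 X Y Z : Type*} [RCLike 𝕜] [NormedAddCommGroup X] [NormedSpace 𝕜 X]
  [NormedAddCommGroup Y] [NormedSpace 𝕜 Y] [NormedAddCommGroup Z] [NormedSpace 𝕜 Z]
  {ι κ : Type*} [Fintype ι] [Fintype κ]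

/-- The weak `ℓ²` norm of the finite family `x` is at most `M`. -/
def IsWeakTwoBound (𝕜 : Type*) {X ι : Type*} [RCLike 𝕜] [NormedAddCommGroup X]
    [NormedSpace 𝕜 X] [Fintype ι] (x : ι → X) (M : ℝ) : Prop :=
  ∀ f : StrongDual 𝕜 X, ‖f‖ ≤ 1 → ∑ i, ‖f (x i)‖ ^ 2 ≤ M ^ 2

theorem weakTwoNorm_nonneg {n : ℕ} (x : Fin n → X) : 0 ≤ weakTwoNorm 𝕜 x :=
  Real.iSup_nonneg fun _ => Real.sqrt_nonneg _

theorem weakTwoNorm_le {n : ℕ} {x : Fin n → X} {M : ℝ} (hM : 0 ≤ M)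
    (hx : IsWeakTwoBound 𝕜 x M) : weakTwoNorm 𝕜 x ≤ M := by
  have : Nonempty (Metric.closedBall (0 : StrongDual 𝕜 X) 1) := ⟨⟨0, by simp⟩⟩
  exact ciSup_le fun f => Real.sqrt_le_iff.2 ⟨hM, hx f (mem_closedBall_zero_iff.1 f.2)⟩

theorem isWeakTwoBound_sqrt_sum_norm_sq (x : ι → X) :
    IsWeakTwoBound 𝕜 x √(∑ i, ‖x i‖ ^ 2) := by
  intro f hf
  rw [Real.sq_sqrt (Finset.sum_nonneg fun _ _ => sq_nonneg _)]
  gcongr with i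
  exact (f.le_of_opNorm_le hf _).trans_eq (one_mul _)

theorem isWeakTwoBound_weakTwoNorm {n : ℕ} (x : Fin n → X) :
    IsWeakTwoBound 𝕜 x (weakTwoNorm 𝕜 x) := by
  intro f hf
  have hbdd : BddAbove (Set.range fun f : Metric.closedBall (0 : StrongDual 𝕜 X) 1 =>
      √(∑ i, ‖(f : StrongDual 𝕜 X) (x i)‖ ^ 2)) := by
    refine ⟨√(∑ i, ‖x i‖ ^ 2), ?_⟩
    rintro _ ⟨g, rfl⟩
    exact Real.sqrt_le_iff.2 ⟨Real.sqrt_nonneg _,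
      isWeakTwoBound_sqrt_sum_norm_sq x g.1 (mem_closedBall_zero_iff.1 g.2)⟩
  have h : √(∑ i, ‖f (x i)‖ ^ 2) ≤ weakTwoNorm 𝕜 x := by
    unfold weakTwoNorm
    exact le_ciSup hbdd ⟨f, mem_closedBall_zero_iff.2 hf⟩
  exact (Real.sqrt_le_left (weakTwoNorm_nonneg x)).1 h

/-- A weak `ℓ²` bound is a bound for the norm of the operator `c ↦ ∑ i, c i • x i` on `ℓ²`. -/
theorem isWeakTwoBound_iff {x : ι → X} {M : ℝ} (hM : 0 ≤ M) :
    IsWeakTwoBound 𝕜 x M ↔ ∀ c : ι → 𝕜, ‖∑ i, c i • x i‖ ≤ M * √(∑ i, ‖c i‖ ^ 2) := by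
  constructor
  · intro h c
    obtain ⟨f, hf, hfx⟩ := exists_dual_vector'' 𝕜 (∑ i, c i • x i)
    calc ‖∑ i, c i • x i‖ = ‖f (∑ i, c i • x i)‖ := by simp [hfx]
      _ ≤ ∑ i, ‖f (x i)‖ * ‖c i‖ := by
        rw [map_sum]
        refine (norm_sum_le _ _).trans_eq (Finset.sum_congr rfl fun i _ => ?_)
        rw [map_smul, smul_eq_mul, norm_mul, mul_comm]
      _ ≤ √(∑ i, ‖f (x i)‖ ^ 2) * √(∑ i, ‖c i‖ ^ 2) := Real.sum_mul_le_sqrt_mul_sqrt _ _ _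
      _ ≤ M * √(∑ i, ‖c i‖ ^ 2) := by
        gcongr
        exact Real.sqrt_le_iff.2 ⟨hM, h f hf⟩
  · intro h f hf
    set S := ∑ i, ‖f (x i)‖ ^ 2 with hS
    have hS0 : 0 ≤ S := Finset.sum_nonneg fun _ _ => sq_nonneg _
    have h1 : S ≤ M * √S := by
      -- The coefficients `conj (f (x i))` are the equality case of Cauchy–Schwarz.
      calc S = ‖f (∑ i, (starRingEnd 𝕜) (f (x i)) • x i)‖ := by
            simp only [map_sum, map_smul, smul_eq_mul, RCLike.conj_mul]
            rw [← RCLike.norm_of_nonneg (K := 𝕜) hS0, hS]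
            push_cast
            rfl
        _ ≤ ‖∑ i, (starRingEnd 𝕜) (f (x i)) • x i‖ :=
            (f.le_of_opNorm_le hf _).trans_eq (one_mul _)
        _ ≤ M * √(∑ i, ‖(starRingEnd 𝕜) (f (x i))‖ ^ 2) := h _
        _ = M * √S := by simp only [RCLike.norm_conj, hS]
    rw [← Real.sqrt_le_left hM]
    rcases (Real.sqrt_nonneg S).eq_or_lt with h0 | h0
    · rwa [← h0]
    · refine le_of_mul_le_mul_right ?_ h0
      rwa [Real.mul_self_sqrt hS0]

theorem isWeakTwoBound_comp_isometry (e : X →ₗᵢ[𝕜] Z) {x : ι → X} {M : ℝ} (hM : 0 ≤ M) :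
    IsWeakTwoBound 𝕜 (fun i => e (x i)) M ↔ IsWeakTwoBound 𝕜 x M := by
  simp only [isWeakTwoBound_iff hM, ← map_smul, ← map_sum, e.norm_map]

theorem IsWeakTwoBound.add {x y : ι → X} {M N : ℝ} (hM : 0 ≤ M) (hN : 0 ≤ N)
    (hx : IsWeakTwoBound 𝕜 x M) (hy : IsWeakTwoBound 𝕜 y N) :
    IsWeakTwoBound 𝕜 (fun i => x i + y i) (M + N) := by
  rw [isWeakTwoBound_iff] at *
  · intro c
    simp only [smul_add, Finset.sum_add_distrib, add_mul]
    exact (norm_add_le _ _).trans (add_le_add (hx c) (hy c))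
  all_goals positivity

/-- General functionals on the tensor product are avoided: in the `ℓ²` operator form only the
injective norm of a combination matters, and that norm is tested on products `f ⊗ g`, for which the
double sum factors. -/
theorem IsWeakTwoBound.tmul {x : ι → X} {y : κ → Y} {M N : ℝ} (hM : 0 ≤ M) (hN : 0 ≤ N)
    (hx : IsWeakTwoBound 𝕜 x M) (hy : IsWeakTwoBound 𝕜 y N) :
    IsWeakTwoBound 𝕜 (fun p : ι × κ =>
      (InjectiveTensorProduct.toTensor 𝕜 X Y).symm (x p.1 ⊗ₜ[𝕜] y p.2)) (M * N) := by
  rw [isWeakTwoBound_iff (mul_nonneg hM hN)]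
  intro c
  rw [InjectiveTensorProduct.norm_def]
  have : Nonempty (Metric.closedBall (0 : StrongDual 𝕜 X) 1 ×
      Metric.closedBall (0 : StrongDual 𝕜 Y) 1) := ⟨⟨⟨0, by simp⟩, ⟨0, by simp⟩⟩⟩
  refine ciSup_le fun ⟨⟨f, hf⟩, ⟨g, hg⟩⟩ => ?_
  simp only [map_sum, map_smul, InjectiveTensorProduct.pairing_tmul]
  calc ‖∑ p, c p • (f (x p.1) * g (y p.2))‖
      ≤ ∑ p : ι × κ, ‖f (x p.1) * g (y p.2)‖ * ‖c p‖ := by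
        refine (norm_sum_le _ _).trans_eq (Finset.sum_congr rfl fun i _ => ?_)
        rw [smul_eq_mul, norm_mul, mul_comm]
    _ ≤ √(∑ p : ι × κ, ‖f (x p.1) * g (y p.2)‖ ^ 2) * √(∑ p, ‖c p‖ ^ 2) :=
        Real.sum_mul_le_sqrt_mul_sqrt _ _ _
    _ ≤ M * N * √(∑ p, ‖c p‖ ^ 2) := by
        gcongr
        refine Real.sqrt_le_iff.2 ⟨by positivity, ?_⟩
        simp only [norm_mul, mul_pow, Fintype.sum_prod_type, ← Finset.mul_sum, ← Finset.sum_mul]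
        exact mul_le_mul (hx f (by simpa using hf)) (hy g (by simpa using hg))
          (Finset.sum_nonneg fun _ _ => sq_nonneg _) (sq_nonneg _)

end WeakTwoBound

/-! ### The 2-summing inequality and its best constant. -/

section TwoSumming

variable {𝕜 X Y : Type*} [RCLike 𝕜] [NormedAddCommGroup X] [NormedSpace 𝕜 X]
  [NormedAddCommGroup Y] [NormedSpace 𝕜 Y] {φ : X →L[𝕜] Y} {C : ℝ≥0}

theorem twoSummingBound_of_sum_sq_le
    (h : ∀ (n : ℕ) (x : Fin n → X) (M : ℝ), 0 ≤ M → IsWeakTwoBound 𝕜 x M →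
      ∑ i, ‖φ (x i)‖ ^ 2 ≤ (C * M) ^ 2) : TwoSummingBound φ C := fun n x =>
  Real.sqrt_le_iff.2 ⟨mul_nonneg C.coe_nonneg (weakTwoNorm_nonneg x),
    h n x _ (weakTwoNorm_nonneg x) (isWeakTwoBound_weakTwoNorm x)⟩

/-- Frees the inequality from `Fin n`; families indexed by products are needed later. -/
theorem TwoSummingBound.sum_sq_le (h : TwoSummingBound φ C) {ι : Type*} [Fintype ι]
    {x : ι → X} {M : ℝ} (hM : 0 ≤ M) (hx : IsWeakTwoBound 𝕜 x M) :
    ∑ i, ‖φ (x i)‖ ^ 2 ≤ (C * M) ^ 2 := by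
  let e := Fintype.equivFin ι
  have hx' : IsWeakTwoBound 𝕜 (x ∘ e.symm) M := fun f hf =>
    (e.symm.sum_comp fun i => ‖f (x i)‖ ^ 2).trans_le (hx f hf)
  rw [← e.symm.sum_comp, ← Real.sqrt_le_left (by positivity)]
  refine (h _ (x ∘ e.symm)).trans ?_
  gcongr
  exact weakTwoNorm_le hM hx'

theorem twoSummingNorm_le (h : TwoSummingBound φ C) : twoSummingNorm φ ≤ C :=
  iInf₂_le C h

theorem IsTwoSumming.twoSummingNorm_ne_top (h : IsTwoSumming φ) : twoSummingNorm φ ≠ ∞ :=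
  let ⟨_, hC⟩ := h
  ne_top_of_le_ne_top ENNReal.coe_ne_top (twoSummingNorm_le hC)

/-- The infimum in the definition of the 2-summing norm is attained. -/
theorem IsTwoSumming.twoSummingBound_toNNReal (h : IsTwoSumming φ) :
    TwoSummingBound φ (twoSummingNorm φ).toNNReal := by
  intro n x
  refine le_of_forall_pos_le_add fun ε hε => ?_
  set w := weakTwoNorm 𝕜 x with hw
  have hw0 : 0 ≤ w := weakTwoNorm_nonneg x
  -- The slack `ε / (w + 1)` costs at most `ε` after multiplication by `w`; the `+ 1` covers `w =
  -- 0`.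
  obtain ⟨C, hC, hlt⟩ : ∃ C : ℝ≥0, TwoSummingBound φ C ∧
      (C : ℝ≥0∞) < ((twoSummingNorm φ).toNNReal + Real.toNNReal (ε / (w + 1)) : ℝ≥0) := by
    have : twoSummingNorm φ <
        ((twoSummingNorm φ).toNNReal + Real.toNNReal (ε / (w + 1)) : ℝ≥0) := by
      rw [ENNReal.coe_add, ENNReal.coe_toNNReal h.twoSummingNorm_ne_top]
      refine ENNReal.lt_add_right h.twoSummingNorm_ne_top ?_
      simp only [ne_eq, ENNReal.coe_eq_zero, Real.toNNReal_eq_zero, not_le]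
      positivity
    conv_lhs at this => rw [twoSummingNorm]
    simpa only [iInf_lt_iff, exists_prop] using this
  have hlt' : (C : ℝ) < (twoSummingNorm φ).toNNReal + ε / (w + 1) := by
    have := NNReal.coe_lt_coe.2 (ENNReal.coe_lt_coe.1 hlt)
    rwa [NNReal.coe_add, Real.coe_toNNReal _ (by positivity)] at this
  calc √(∑ i, ‖φ (x i)‖ ^ 2) ≤ C * w := hC n x
    _ ≤ ((twoSummingNorm φ).toNNReal + ε / (w + 1)) * w := by gcongr
    _ = (twoSummingNorm φ).toNNReal * w + ε * (w / (w + 1)) := by ring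
    _ ≤ (twoSummingNorm φ).toNNReal * w + ε := by
      gcongr
      exact mul_le_of_le_one_right hε.le ((div_le_one (by positivity)).2 (by linarith))

/-- An operator into a finite-dimensional Hilbert space is 2-summing. -/
theorem isTwoSumming_of_finiteDimensional {H : Type*} [NormedAddCommGroup H]
    [InnerProductSpace 𝕜 H] [FiniteDimensional 𝕜 H] (φ : X →L[𝕜] H) : IsTwoSumming φ := by
  let b := stdOrthonormalBasis 𝕜 H
  let d := Module.finrank 𝕜 H
  refine ⟨.mk (√d * ‖φ‖) (by positivity), twoSummingBound_of_sum_sq_le fun n x M hM hx => ?_⟩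
  -- Each of the `d` coordinates is a functional of norm at most `1`, whence the constant `√d *
  -- ‖φ‖`.
  have key : ∀ l, ∑ i, ‖inner 𝕜 (b l) (φ (x i))‖ ^ 2 ≤ (‖φ‖ * M) ^ 2 := by
    intro l
    rw [← Real.sqrt_le_left (by positivity)]
    have h1 : IsWeakTwoBound 𝕜 (fun i => φ (x i)) (‖φ‖ * M) := by
      rw [isWeakTwoBound_iff hM] at hx
      rw [isWeakTwoBound_iff (by positivity)]
      intro c
      simp only [← map_smul, ← map_sum]
      refine (φ.le_opNorm _).trans ?_
      rw [mul_assoc]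
      gcongr
      exact hx c
    have h2 := h1 (innerSL 𝕜 (b l)) (by simp)
    exact (Real.sqrt_le_left (by positivity)).2 (by simpa using h2)
  calc ∑ i, ‖φ (x i)‖ ^ 2 = ∑ l, ∑ i, ‖inner 𝕜 (b l) (φ (x i))‖ ^ 2 := by
        rw [Finset.sum_comm]
        simp only [b.sum_sq_norm_inner_right]
    _ ≤ ∑ _l : Fin d, (‖φ‖ * M) ^ 2 := Finset.sum_le_sum fun l _ => key l
    _ = (√d * ‖φ‖ * M) ^ 2 := by
        simp only [Finset.sum_const, Finset.card_univ, Fintype.card_fin, nsmul_eq_mul, mul_pow]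
        rw [Real.sq_sqrt (by positivity)]
        ring

end TwoSumming

/-! ### Passage to completions. -/

section Completion

open UniformSpace

variable {𝕜 X Y : Type*} [RCLike 𝕜] [NormedAddCommGroup X] [NormedSpace 𝕜 X]
  [NormedAddCommGroup Y] [NormedSpace 𝕜 Y] {φ : X →L[𝕜] Y} {C : ℝ≥0}

/-- An operator has the same 2-summing bounds as its extension to the completions. -/
theorem twoSummingBound_completion_iff :
    TwoSummingBound φ.completion C ↔ TwoSummingBound φ C := by
  let e : X →ₗᵢ[𝕜] Completion X := Completion.toComplₗᵢ
  constructor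
  · refine fun h => twoSummingBound_of_sum_sq_le fun n x M hM hx => ?_
    have := h.sum_sq_le hM ((isWeakTwoBound_comp_isometry e hM).2 hx)
    simpa [e] using this
  · refine fun h => twoSummingBound_of_sum_sq_le fun n x M hM hx => ?_
    have hdense : DenseRange (Pi.map fun _ : Fin n => ((↑) : X → Completion X)) :=
      DenseRange.piMap fun _ => Completion.denseRange_coe
    -- The error term makes the inequality a closed condition on `y` that holds on the dense set of
    -- families from `X`, whose weak bound is `M` plus the distance to `x`. At `y = x` the error
    -- vanishes.
    have hclosed : IsClosed {y : Fin n → Completion X |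
        ∑ i, ‖φ.completion (y i)‖ ^ 2 ≤ (C * (M + √(∑ i, ‖y i - x i‖ ^ 2))) ^ 2} :=
      isClosed_le (by fun_prop) (by fun_prop)
    have key : ∀ y : Fin n → Completion X,
        ∑ i, ‖φ.completion (y i)‖ ^ 2 ≤ (C * (M + √(∑ i, ‖y i - x i‖ ^ 2))) ^ 2 := by
      refine isClosed_property hdense hclosed fun z => ?_
      have h0 : 0 ≤ M + √(∑ i, ‖(z i : Completion X) - x i‖ ^ 2) := by positivity
      have h1 := hx.add hM (Real.sqrt_nonneg _)
        (isWeakTwoBound_sqrt_sum_norm_sq fun i => (z i : Completion X) - x i)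
      simp only [add_sub_cancel] at h1
      simpa [e] using h.sum_sq_le h0 ((isWeakTwoBound_comp_isometry e h0).1 h1)
    simpa using key x

theorem twoSummingNorm_completion (φ : X →L[𝕜] Y) :
    twoSummingNorm φ.completion = twoSummingNorm φ := by
  simp only [twoSummingNorm, twoSummingBound_completion_iff]

end Completion

/-! ### Contractions and norms in Hilbert tensor products. -/

namespace TensorProduct

/-- Contraction of the left factor of a tensor product with a linear functional. -/
noncomputable def contractLeftFactor {R E : Type*} (F : Type*) [CommRing R] [AddCommGroup E]
    [Module R E] [AddCommGroup F] [Module R F] (f : E →ₗ[R] R) : E ⊗[R] F →ₗ[R] F :=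
  (TensorProduct.lid R F).toLinearMap ∘ₗ f.rTensor F

@[simp]
theorem contractLeftFactor_tmul {R E F : Type*} [CommRing R] [AddCommGroup E]
    [Module R E] [AddCommGroup F] [Module R F] (f : E →ₗ[R] R) (x : E) (y : F) :
    contractLeftFactor F f (x ⊗ₜ y) = f x • y := by
  simp [contractLeftFactor]

/-- Contraction of the right factor of a tensor product with a linear functional. -/
noncomputable def contractRightFactor {R F : Type*} (E : Type*) [CommRing R] [AddCommGroup E]
    [Module R E] [AddCommGroup F] [Module R F] (g : F →ₗ[R] R) : E ⊗[R] F →ₗ[R] E :=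
  (TensorProduct.rid R E).toLinearMap ∘ₗ g.lTensor E

@[simp]
theorem contractRightFactor_tmul {R E F : Type*} [CommRing R] [AddCommGroup E]
    [Module R E] [AddCommGroup F] [Module R F] (g : F →ₗ[R] R) (x : E) (y : F) :
    contractRightFactor E g (x ⊗ₜ y) = g y • x := by
  simp [contractRightFactor]

variable {𝕜 H₁ H₂ : Type*} [RCLike 𝕜] [NormedAddCommGroup H₁] [InnerProductSpace 𝕜 H₁]
  [NormedAddCommGroup H₂] [InnerProductSpace 𝕜 H₂]

theorem norm_sq_sum_tmul_of_orthonormal {ι : Type*} [Fintype ι] {b : ι → H₁}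
    (hb : Orthonormal 𝕜 b) (v : ι → H₂) : ‖∑ l, b l ⊗ₜ[𝕜] v l‖ ^ 2 = ∑ l, ‖v l‖ ^ 2 := by
  classical
  rw [← inner_self_eq_norm_sq (𝕜 := 𝕜)]
  simp only [sum_inner, inner_sum, inner_tmul, orthonormal_iff_ite.1 hb, ite_mul, one_mul,
    zero_mul, Finset.sum_ite_eq', Finset.mem_univ, if_true]
  simp only [map_sum, inner_self_eq_norm_sq]

/-- Finitely many elements of `H₁ ⊗ H₂` have their norms computed by the contractions with one
finite orthonormal family of `H₁`. -/
theorem exists_orthonormal_norm_sq_eq (s : Set (H₁ ⊗[𝕜] H₂)) (hs : s.Finite) :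
    ∃ (d : ℕ) (b : Fin d → H₁), Orthonormal 𝕜 b ∧ ∀ t ∈ s,
      ‖t‖ ^ 2 = ∑ l, ‖contractLeftFactor H₂ (innerSL 𝕜 (b l) : H₁ →ₗ[𝕜] 𝕜) t‖ ^ 2 := by
  obtain ⟨K, hK, hsK⟩ := exists_finite_submodule_left_of_setFinite s hs
  let b := stdOrthonormalBasis 𝕜 K
  have hb : Orthonormal 𝕜 fun l => (b l : H₁) := b.orthonormal.comp_linearIsometry K.subtypeₗᵢ
  refine ⟨_, fun l => (b l : H₁), hb, fun t ht => ?_⟩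
  -- The induction runs over `K ⊗ H₂`, so every left factor lies in `K` and expands in `b`.
  have hsum : ∀ u : K ⊗[𝕜] H₂, K.subtype.rTensor H₂ u = ∑ l, (b l : H₁) ⊗ₜ[𝕜]
      contractLeftFactor H₂ (innerSL 𝕜 (b l : H₁) : H₁ →ₗ[𝕜] 𝕜) (K.subtype.rTensor H₂ u) := by
    intro u
    induction u with
    | zero => simp
    | add u v hu hv =>
      simp only [map_add, tmul_add, Finset.sum_add_distrib]
      rw [← hu, ← hv]
    | tmul x y =>
      have hx : ∑ l, inner 𝕜 (b l : H₁) (x : H₁) • (b l : H₁) = x := by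
        simpa using congrArg K.subtype (b.sum_repr' x)
      simp only [LinearMap.rTensor_tmul, Submodule.subtype_apply, contractLeftFactor_tmul,
        ContinuousLinearMap.coe_coe, innerSL_apply_apply, ← smul_tmul, ← sum_tmul]
      rw [hx]
  obtain ⟨u, rfl⟩ := hsK ht
  conv_lhs => rw [hsum u]
  exact norm_sq_sum_tmul_of_orthonormal hb _

end TensorProduct

/-! ### The two bounds for `φ₁ ⊗ φ₂`. -/

namespace InjectiveTensorProduct

open TensorProduct

variable {𝕜 X₁ X₂ H₁ H₂ : Type*} [RCLike 𝕜]
    [NormedAddCommGroup X₁] [NormedSpace 𝕜 X₁] [NormedAddCommGroup X₂] [NormedSpace 𝕜 X₂]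
    [NormedAddCommGroup H₁] [InnerProductSpace 𝕜 H₁]
    [NormedAddCommGroup H₂] [InnerProductSpace 𝕜 H₂]
    {φ₁ : X₁ →L[𝕜] H₁} {φ₂ : X₂ →L[𝕜] H₂} {C₁ C₂ : ℝ≥0}

/-- By definition of the injective norm, `f ⊗ g` is a functional of norm at most `1`. -/
theorem sum_sq_pairing_le {ι : Type*} [Fintype ι] {z : ι → InjectiveTensorProduct 𝕜 X₁ X₂}
    {M : ℝ} (hz : IsWeakTwoBound 𝕜 z M) {f : StrongDual 𝕜 X₁} {g : StrongDual 𝕜 X₂}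
    (hf : ‖f‖ ≤ 1) (hg : ‖g‖ ≤ 1) : ∑ i, ‖pairing f g (z i)‖ ^ 2 ≤ M ^ 2 := by
  refine hz ((pairing f g).mkContinuous 1 fun z => ?_)
    (LinearMap.mkContinuous_norm_le _ zero_le_one _)
  rw [one_mul, norm_def]
  exact le_ciSup (bddAbove_pairing z)
    ⟨⟨f, mem_closedBall_zero_iff.2 hf⟩, ⟨g, mem_closedBall_zero_iff.2 hg⟩⟩

theorem sum_sq_norm_map_le (h₁ : TwoSummingBound φ₁ C₁) (h₂ : TwoSummingBound φ₂ C₂)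
    {ι : Type*} [Fintype ι] {z : ι → InjectiveTensorProduct 𝕜 X₁ X₂} {M : ℝ} (hM : 0 ≤ M)
    (hz : IsWeakTwoBound 𝕜 z M) :
    ∑ i, ‖map φ₁ φ₂ (z i)‖ ^ 2 ≤ ((C₁ * C₂ : ℝ≥0) * M) ^ 2 := by
  obtain ⟨d, b, hb, hnorm⟩ := exists_orthonormal_norm_sq_eq
    (Set.range fun i => map φ₁ φ₂ (z i)) (Set.finite_range _)
  let w : ι × Fin d → X₂ := fun p =>
    contractLeftFactor X₂ ((innerSL 𝕜 (b p.2)).comp φ₁ : X₁ →ₗ[𝕜] 𝕜) (toTensor 𝕜 X₁ X₂ (z p.1))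
  have hw : IsWeakTwoBound 𝕜 w (C₁ * M) := by
    intro g hg
    let v : ι → X₁ := fun i =>
      contractRightFactor X₁ (g : X₂ →ₗ[𝕜] 𝕜) (toTensor 𝕜 X₁ X₂ (z i))
    have hv : IsWeakTwoBound 𝕜 v M := by
      intro f hf
      have hft : ∀ t, f (contractRightFactor X₁ (g : X₂ →ₗ[𝕜] 𝕜) t) =
          pairing f g ((toTensor 𝕜 X₁ X₂).symm t) := fun t => by
        induction t with
        | zero => simp
        | add s t hs ht => simp only [map_add, hs, ht]
        | tmul x y => simp [pairing_tmul, mul_comm]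
      have hfv : ∀ i, f (v i) = pairing f g (z i) := fun i => by
        simp only [v, hft, LinearEquiv.symm_apply_apply]
      simpa only [hfv] using sum_sq_pairing_le hz hf hg
    have hgw : ∀ p, g (w p) = inner 𝕜 (b p.2) (φ₁ (v p.1)) := fun p => by
      simp only [w, v]
      induction toTensor 𝕜 X₁ X₂ (z p.1) with
      | zero => simp
      | add s t hs ht => simp only [map_add, inner_add_right, hs, ht]
      | tmul x y => simp [mul_comm, inner_smul_right]
    calc ∑ p, ‖g (w p)‖ ^ 2 = ∑ i, ∑ l, ‖inner 𝕜 (b l) (φ₁ (v i))‖ ^ 2 := by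
          simp only [hgw, Fintype.sum_prod_type]
      _ ≤ ∑ i, ‖φ₁ (v i)‖ ^ 2 :=
          -- Bessel suffices: `b` need not span the vectors `φ₁ (v i)`.
          Finset.sum_le_sum fun i _ => hb.sum_inner_products_le (φ₁ (v i))
      _ ≤ (C₁ * M) ^ 2 := h₁.sum_sq_le hM hv
  have hφw : ∀ p, φ₂ (w p) = contractLeftFactor H₂ (innerSL 𝕜 (b p.2) : H₁ →ₗ[𝕜] 𝕜)
      (map φ₁ φ₂ (z p.1)) := fun p => by
    simp only [w, map, LinearMap.comp_apply, LinearEquiv.coe_coe]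
    induction toTensor 𝕜 X₁ X₂ (z p.1) with
    | zero => simp
    | add s t hs ht => simp only [map_add, hs, ht]
    | tmul x y => simp
  calc ∑ i, ‖map φ₁ φ₂ (z i)‖ ^ 2 = ∑ p, ‖φ₂ (w p)‖ ^ 2 := by
        simp only [hφw, Fintype.sum_prod_type]
        exact Finset.sum_congr rfl fun i _ => hnorm _ ⟨i, rfl⟩
    _ ≤ (C₂ * (C₁ * M)) ^ 2 := h₂.sum_sq_le (by positivity) hw
    _ = ((C₁ * C₂ : ℝ≥0) * M) ^ 2 := by push_cast; ring

/-- The tensor product of two 2-summing operators as a bounded operator between the algebraic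
tensor products. -/
theorem exists_continuousLinearMap (h₁ : IsTwoSumming φ₁) (h₂ : IsTwoSumming φ₂) :
    ∃ T : InjectiveTensorProduct 𝕜 X₁ X₂ →L[𝕜] H₁ ⊗[𝕜] H₂, ∀ z, T z = map φ₁ φ₂ z := by
  obtain ⟨C₁, h₁⟩ := h₁
  obtain ⟨C₂, h₂⟩ := h₂
  refine ⟨(map φ₁ φ₂).mkContinuous (C₁ * C₂ : ℝ≥0) fun z => ?_, fun z => rfl⟩
  -- Boundedness is the 2-summing estimate for a one-element family.
  have h : IsWeakTwoBound 𝕜 (fun _ : Unit => z) ‖z‖ := by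
    simpa using isWeakTwoBound_sqrt_sum_norm_sq (𝕜 := 𝕜) (fun _ : Unit => z)
  have := sum_sq_norm_map_le h₁ h₂ (norm_nonneg z) h
  exact (sq_le_sq₀ (norm_nonneg _) (by positivity)).1 (by simpa using this)

variable {T : InjectiveTensorProduct 𝕜 X₁ X₂ →L[𝕜] H₁ ⊗[𝕜] H₂}

theorem twoSummingBound_of_eq_map (hT : ∀ z, T z = map φ₁ φ₂ z)
    (h₁ : TwoSummingBound φ₁ C₁) (h₂ : TwoSummingBound φ₂ C₂) : TwoSummingBound T (C₁ * C₂) :=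
  twoSummingBound_of_sum_sq_le fun n z M hM hz => by
    simpa only [hT] using sum_sq_norm_map_le h₁ h₂ hM hz

theorem mul_le_of_twoSummingBound (hT : ∀ z, T z = map φ₁ φ₂ z) {C : ℝ≥0}
    (h : TwoSummingBound T C) {m n : ℕ} (x : Fin m → X₁) (y : Fin n → X₂) :
    √(∑ i, ‖φ₁ (x i)‖ ^ 2) * √(∑ j, ‖φ₂ (y j)‖ ^ 2) ≤
      C * (weakTwoNorm 𝕜 x * weakTwoNorm 𝕜 y) := by
  have hx := weakTwoNorm_nonneg (𝕜 := 𝕜) x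
  have hy := weakTwoNorm_nonneg (𝕜 := 𝕜) y
  have := h.sum_sq_le (mul_nonneg hx hy)
    ((isWeakTwoBound_weakTwoNorm x).tmul hx hy (isWeakTwoBound_weakTwoNorm y))
  rw [← Real.sqrt_mul (Finset.sum_nonneg fun _ _ => sq_nonneg _)]
  refine Real.sqrt_le_iff.2 ⟨by positivity, ?_⟩
  simpa [hT, map, mul_pow, Fintype.sum_prod_type, Finset.sum_mul_sum] using this

/-- The two infima are taken one at a time: with `x` fixed, the product inequality bounds `φ₂` by a
quotient depending on `x`, so `p` is at most that quotient; letting `x` vary then gives the bound `C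
/ p` for `φ₁`. -/
theorem twoSummingNorm_mul_le (hT : ∀ z, T z = map φ₁ φ₂ z) (h₂ : IsTwoSumming φ₂)
    {C : ℝ≥0} (h : TwoSummingBound T C) : twoSummingNorm φ₁ * twoSummingNorm φ₂ ≤ C := by
  set p := (twoSummingNorm φ₂).toNNReal with hp
  have hp' : twoSummingNorm φ₂ = p := (ENNReal.coe_toNNReal h₂.twoSummingNorm_ne_top).symm
  rcases eq_or_ne p 0 with h0 | h0
  · simp [hp', h0]
  have key : ∀ (m : ℕ) (x : Fin m → X₁), √(∑ i, ‖φ₁ (x i)‖ ^ 2) * p ≤ C * weakTwoNorm 𝕜 x := by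
    intro m x
    rcases (Real.sqrt_nonneg (∑ i, ‖φ₁ (x i)‖ ^ 2)).eq_or_lt with hS | hS
    · rw [← hS, zero_mul]
      exact mul_nonneg C.coe_nonneg (weakTwoNorm_nonneg x)
    have hb : TwoSummingBound φ₂ (.mk (C * weakTwoNorm 𝕜 x / √(∑ i, ‖φ₁ (x i)‖ ^ 2))
        (div_nonneg (mul_nonneg C.coe_nonneg (weakTwoNorm_nonneg x)) hS.le)) := by
      intro n y
      rw [NNReal.coe_mk, div_mul_eq_mul_div, le_div_iff₀ hS, mul_comm, mul_assoc]
      exact mul_le_of_twoSummingBound hT h x y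
    have := twoSummingNorm_le hb
    rw [hp', ENNReal.coe_le_coe, ← NNReal.coe_le_coe, NNReal.coe_mk, le_div_iff₀ hS] at this
    rwa [mul_comm]
  have hb : TwoSummingBound φ₁ (C / p) := by
    intro m x
    rw [NNReal.coe_div, div_mul_eq_mul_div, le_div_iff₀ (by positivity)]
    exact key m x
  calc twoSummingNorm φ₁ * twoSummingNorm φ₂ ≤ (C / p : ℝ≥0) * p := by
        rw [hp']
        gcongr
        exact twoSummingNorm_le hb
    _ = C := by rw [← ENNReal.coe_mul, div_mul_cancel₀ _ h0]

theorem isTwoSumming_and_twoSummingNorm_eq (hT : ∀ z, T z = map φ₁ φ₂ z)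
    (h₁ : IsTwoSumming φ₁) (h₂ : IsTwoSumming φ₂) :
    IsTwoSumming T ∧ twoSummingNorm T = twoSummingNorm φ₁ * twoSummingNorm φ₂ := by
  have hb := twoSummingBound_of_eq_map hT h₁.twoSummingBound_toNNReal h₂.twoSummingBound_toNNReal
  refine ⟨⟨_, hb⟩, le_antisymm ((twoSummingNorm_le hb).trans_eq ?_)
    (le_iInf₂ fun C hC => twoSummingNorm_mul_le hT h₂ hC)⟩
  rw [ENNReal.coe_mul, ENNReal.coe_toNNReal h₁.twoSummingNorm_ne_top,
    ENNReal.coe_toNNReal h₂.twoSummingNorm_ne_top]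

end InjectiveTensorProduct

theorem mainTheorem3 {𝕜 : Type*} [RCLike 𝕜] {X₁ X₂ H₁ H₂ : Type*}
    [NormedAddCommGroup X₁] [NormedSpace 𝕜 X₁] [NormedAddCommGroup X₂] [NormedSpace 𝕜 X₂]
    [NormedAddCommGroup H₁] [InnerProductSpace 𝕜 H₁]
    [NormedAddCommGroup H₂] [InnerProductSpace 𝕜 H₂] :
    -- Banach spaces `X₁`, `X₂` and Hilbert spaces `H₁`, `H₂`
    (∀ [CompleteSpace X₁] [CompleteSpace X₂] [CompleteSpace H₁] [CompleteSpace H₂]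
      (φ₁ : X₁ →L[𝕜] H₁) (φ₂ : X₂ →L[𝕜] H₂), IsTwoSumming φ₁ → IsTwoSumming φ₂ →
      ∃ T : UniformSpace.Completion (InjectiveTensorProduct 𝕜 X₁ X₂) →L[𝕜]
          UniformSpace.Completion (H₁ ⊗[𝕜] H₂),
        (∀ z : InjectiveTensorProduct 𝕜 X₁ X₂,
          T (z : UniformSpace.Completion (InjectiveTensorProduct 𝕜 X₁ X₂)) =
            ((InjectiveTensorProduct.map φ₁ φ₂ z : H₁ ⊗[𝕜] H₂) :
              UniformSpace.Completion (H₁ ⊗[𝕜] H₂))) ∧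
        (∀ T' : UniformSpace.Completion (InjectiveTensorProduct 𝕜 X₁ X₂) →L[𝕜]
            UniformSpace.Completion (H₁ ⊗[𝕜] H₂),
          (∀ z : InjectiveTensorProduct 𝕜 X₁ X₂,
            T' (z : UniformSpace.Completion (InjectiveTensorProduct 𝕜 X₁ X₂)) =
              ((InjectiveTensorProduct.map φ₁ φ₂ z : H₁ ⊗[𝕜] H₂) :
                UniformSpace.Completion (H₁ ⊗[𝕜] H₂))) → T' = T) ∧
        IsTwoSumming T ∧
        twoSummingNorm T = twoSummingNorm φ₁ * twoSummingNorm φ₂) ∧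
    -- finite-dimensional spaces, where no completion is needed and every operator is allowed
    (∀ [FiniteDimensional 𝕜 X₁] [FiniteDimensional 𝕜 X₂]
      [FiniteDimensional 𝕜 H₁] [FiniteDimensional 𝕜 H₂]
      (φ₁ : X₁ →L[𝕜] H₁) (φ₂ : X₂ →L[𝕜] H₂),
      ∃ T : InjectiveTensorProduct 𝕜 X₁ X₂ →L[𝕜] H₁ ⊗[𝕜] H₂,
        (∀ z : InjectiveTensorProduct 𝕜 X₁ X₂, T z = InjectiveTensorProduct.map φ₁ φ₂ z) ∧
        IsTwoSumming T ∧
        twoSummingNorm T = twoSummingNorm φ₁ * twoSummingNorm φ₂) := by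
  refine ⟨fun φ₁ φ₂ h₁ h₂ => ?_, fun φ₁ φ₂ => ?_⟩
  · obtain ⟨T, hT⟩ := InjectiveTensorProduct.exists_continuousLinearMap h₁ h₂
    obtain ⟨⟨C, hC⟩, hnorm⟩ := InjectiveTensorProduct.isTwoSumming_and_twoSummingNorm_eq hT h₁ h₂
    have hcoe : ∀ z : InjectiveTensorProduct 𝕜 X₁ X₂, T.completion z =
        ((InjectiveTensorProduct.map φ₁ φ₂ z : H₁ ⊗[𝕜] H₂) :
          UniformSpace.Completion (H₁ ⊗[𝕜] H₂)) := fun z => by simp [hT]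
    refine ⟨T.completion, hcoe, fun T' hT' => ?_, ⟨C, twoSummingBound_completion_iff.2 hC⟩,
      (twoSummingNorm_completion T).trans hnorm⟩
    refine ContinuousLinearMap.coeFn_injective
      -- Continuous maps agreeing on the dense algebraic tensor product coincide.
      (UniformSpace.Completion.ext T'.continuous T.completion.continuous fun z => ?_)
    rw [hT', hcoe]
  · have h₁ := isTwoSumming_of_finiteDimensional φ₁
    have h₂ := isTwoSumming_of_finiteDimensional φ₂
    obtain ⟨T, hT⟩ := InjectiveTensorProduct.exists_continuousLinearMap h₁ h₂
    exact ⟨T, hT, InjectiveTensorProduct.isTwoSumming_and_twoSummingNorm_eq hT h₁ h₂⟩
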